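/- **Model.** $N$ D2D pairs share one channel; in each time slot $t=0,1,2,\dots$ exactly one user is scheduled. The fading vectors $H(t)=(h_1(t),\dots,h_N(t))$ are i.i.d. over $t$ with a known law $\nu$ whose marginals are standard complex Gaussian. User $n$ can use a bit rate $\mathsf R_m\ge 0$ ($m=1,\dots,M$), which costs the power $P_{n,m}=\min\{\mathsf S_mN_o/(|h_n|^2L_n),P_{\max}\}$, where $\mathsf S_m\ge0$ and $N_o,L_n,P_{\max}>0$. If $n$ is scheduled at level $m$ in slot $t$, then $P_n(t)=P_{n,m}$ and $R_n(t)=\mathsf R_m$; for the other users $P_n(t)=R_n(t)=0$. **Centralized limited-feedback policies.** Let $1\le K^{(1)}\le N$. In every slot the base station chooses a set of at most $K^{(1)}$ users from its prior information (statistics, initial queues and possibly randomization, jointly independent of the channels) and the CSI reported in earlier slots. It receives the current CSI of these users only, and then schedules one of them at some level, as a function of all it has been told so far. A policy is feasible if $\liminf_{T}\frac1T\sum_{t=1}^T\mathbb E[R_n(t)]\ge R_{th}$ for all $n$, where $R_{th}\ge0$. Let $P_c^*$ be the infimum of $\limsup_T\frac1T\sum_{t=1}^T\sum_n\mathbb E[P_n(t)]$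 over feasible policies; assume that a feasible policy exists. **Algorithm $\Gamma^{cent}$.** Let $V>0$, and let $Q_n(t+1)=[Q_n(t)-R_n(t)]^++R_{th}$, with $Q_n(0)\ge0$ square integrable and part of the prior information. In slot $t$: 1. choose a set $\Lambda^*$ minimizing $\mathbb E_{h\sim\nu}\big[\min_{n\in\Lambda}\min_m (VP_{n,m}(h_n)-Q_n(t)\mathsf R_m)\big]$ over the sets $\Lambda$ of exactly $K^{(1)}$ users; 2. each $n\in\Lambda^*$ picks a level minimizing $VP_{n,m}-Q_n(t)\mathsf R_m$, and reports the rate $R_n$ and a quantized version $\tilde P_n=q(P_n)$ of the power $P_n$ at this level; 3. schedule, at the level it picked, a user in $\Lambda^*$ minimizing $V\tilde P_n-Q_n(t)R_n$. Ties are broken arbitrarily (as a centralized limited-feedback policy). Let $\delta$ be a bound on the quantization error: $|q(p)-p|\le\delta$ for $0\le p\le P_{\max}$. **Claim.** There is a finite $C$, independent of $V$, of $Q(0)$, of the quantizer and of the tie-breaking, such that under $\Gamma^{cent}$, for all $t$, almost surely $$\mathbb E\Big[\sum_{i=1}^N\tfrac{R_{th}^2+R_i(t)^2}{2}\,\Big|\,Q(t)\Big]\le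 C .$$ For every $C$ with this property, $$P_c^*\le\limsup_{T\to\infty}\frac1T\sum_{t=1}^T\sum_{n=1}^N\mathbb E\big[P_n(\Gamma^{cent}(t))\big]\le P_c^*+\frac CV+2\delta .$$ In particular, if powers are reported exactly ($\delta=0$), the upper bound is $P_c^*+C/V$. -/

import Mathlib

open MeasureTheory ProbabilityTheory Filter

noncomputable section

namespace D2D

/-- Physical parameters of a cell with `N` device-to-device pairs and `M` bit-rate levels:
SNR thresholds, bit rates, path losses, noise power, maximal power, throughput threshold. -/
structure Params (N M : ℕ) where
  snr : Fin M → ℝ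
  bitRate : Fin M → ℝ
  pathLoss : Fin N → ℝ
  noise : ℝ
  pmax : ℝ
  rth : ℝ
  snr_nonneg : ∀ m, 0 ≤ snr m
  bitRate_nonneg : ∀ m, 0 ≤ bitRate m
  pathLoss_pos : ∀ n, 0 < pathLoss n
  noise_pos : 0 < noise
  pmax_pos : 0 < pmax
  rth_nonneg : 0 ≤ rth

/-- Transmission power of pair `n` at level `m` when its fading coefficient is `z`.
(The value at `z = 0` is irrelevant: this has probability zero under Rayleigh fading.) -/
def Params.power {N M : ℕ} (par : Params N M) (n : Fin N) (m : Fin M) (z : ℂ) : ℝ :=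
  min (par.snr m * par.noise / (‖z‖ ^ 2 * par.pathLoss n)) par.pmax

/-- The circularly symmetric complex Gaussian law with mean zero and unit variance: real and
imaginary parts are independent centred real Gaussians of variance `1 / 2`. -/
def stdComplexGaussian : Measure ℂ :=
  ((gaussianReal 0 (1 / 2)).prod (gaussianReal 0 (1 / 2))).map
    (fun p : ℝ × ℝ => (p.1 : ℂ) + (p.2 : ℂ) * Complex.I)

/-- `H t` is the vector of fading coefficients in slot `t`. The vectors are independent and
identically distributed over time with law `ν` (the statistical CSI), and every link is a Rayleigh
fading channel. Nothing is assumed on the dependence between different links. The σ-algebra `𝓐`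
is whatever the base station may know beforehand (initial queues, randomization); it is independent
of the channels. -/
structure IsFadingModel {N : ℕ} {Ω : Type*} (𝓐 : MeasurableSpace Ω) [mΩ : MeasurableSpace Ω]
    (μ : Measure Ω) (ν : Measure (Fin N → ℂ)) (H : ℕ → Ω → Fin N → ℂ) : Prop where
  measurable : ∀ t, Measurable[mΩ] (H t)
  law : ∀ t, μ.map (H t) = ν
  rayleigh : ∀ n, ν.map (fun h => h n) = stdComplexGaussian
  iIndep : iIndepFun H μ
  prior_le : 𝓐 ≤ mΩ
  prior_indep : Indep 𝓐 (⨆ t, MeasurableSpace.comap (H t) inferInstance) μ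

/-- The CSI received by the base station in slot `t` if the users in `Λ t` report: the fading
coefficients of the reporting users (all other coordinates are blanked). -/
def report {N : ℕ} {Ω : Type*} (H : ℕ → Ω → Fin N → ℂ) (Λ : ℕ → Ω → Finset (Fin N))
    (t : ℕ) (ω : Ω) : Fin N → ℂ :=
  fun n => if n ∈ Λ t ω then H t ω n else 0

/-- What the base station knows at the start of slot `t`: its prior information and the reports of
all earlier slots. -/
abbrev known {N : ℕ} {Ω : Type*} (H : ℕ → Ω → Fin N → ℂ) (𝓐 : MeasurableSpace Ω)
    (Λ : ℕ → Ω → Finset (Fin N)) (t : ℕ) : MeasurableSpace Ω :=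
  𝓐 ⊔ ⨆ s : Fin t, MeasurableSpace.comap (report H Λ s) inferInstance

/-- A centralized limited-feedback policy. In slot `t` the base station first requests the CSI of at
most `K` users (set `feedback t`), knowing only what was reported in earlier slots; having received
these reports, it schedules one of the reporting users (`user t`) at one of the bit-rate levels
(`level t`). The choices may depend on time and on the whole past, and may be randomized through
`𝓐`. -/
structure Policy {N : ℕ} {Ω : Type*} (M K : ℕ) (H : ℕ → Ω → Fin N → ℂ)
    (𝓐 : MeasurableSpace Ω) where
  feedback : ℕ → Ω → Finset (Fin N)
  user : ℕ → Ω → Fin N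
  level : ℕ → Ω → Fin M
  card_feedback_le : ∀ t ω, (feedback t ω).card ≤ K
  user_mem : ∀ t ω, user t ω ∈ feedback t ω
  feedback_measurable : ∀ t (A : Finset (Fin N)),
    MeasurableSet[known H 𝓐 feedback t] {ω | feedback t ω = A}
  decision_measurable : ∀ t n m,
    MeasurableSet[known H 𝓐 feedback (t + 1)] {ω | user t ω = n ∧ level t ω = m}

section Performance

variable {N M K : ℕ} {Ω : Type*} {H : ℕ → Ω → Fin N → ℂ} {𝓐 : MeasurableSpace Ω}

/-- The transmission power `P_n(t)`; only the scheduled user transmits. -/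
def Policy.txPower (par : Params N M) (π : Policy M K H 𝓐) (t : ℕ) (n : Fin N) (ω : Ω) : ℝ :=
  if π.user t ω = n then par.power n (π.level t ω) (H t ω n) else 0

/-- The service rate `R_n(t)`; only the scheduled user is served. -/
def Policy.rate (par : Params N M) (π : Policy M K H 𝓐) (t : ℕ) (n : Fin N) (ω : Ω) : ℝ :=
  if π.user t ω = n then par.bitRate (π.level t ω) else 0

/-- Limsup time-average expected total power. -/
def Policy.limsupPower [MeasurableSpace Ω] (par : Params N M) (μ : Measure Ω)
    (π : Policy M K H 𝓐) : ℝ :=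
  limsup (fun T : ℕ => (1 / (T : ℝ)) *
    ∑ t ∈ Finset.Icc 1 T, ∑ n, ∫ ω, π.txPower par t n ω ∂μ) atTop

/-- The throughput constraint: every user has liminf time-average expected rate at least `rth`. -/
def Policy.Feasible [MeasurableSpace Ω] (par : Params N M) (μ : Measure Ω)
    (π : Policy M K H 𝓐) : Prop :=
  ∀ n, par.rth ≤ liminf (fun T : ℕ => (1 / (T : ℝ)) *
    ∑ t ∈ Finset.Icc 1 T, ∫ ω, π.rate par t n ω ∂μ) atTop

/-- The virtual queues `Q(t+1) = [Q(t) - R(t)]⁺ + rth` driven by a policy, started at `Q₀`. -/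
def Policy.queue (par : Params N M) (π : Policy M K H 𝓐) (Q₀ : Ω → Fin N → ℝ) :
    ℕ → Ω → Fin N → ℝ
  | 0 => Q₀
  | t + 1 => fun ω n => max (π.queue par Q₀ t ω n - π.rate par t n ω) 0 + par.rth

/-- `C` bounds the conditional second moment of arrivals and services given the queues, i.e. the
expectation of `∑ (rth² + R_i(t)²) / 2` conditionally on `Q(t)`, in every slot. -/
def Policy.IsDriftConstant [MeasurableSpace Ω] (par : Params N M) (μ : Measure Ω)
    (π : Policy M K H 𝓐) (Q₀ : Ω → Fin N → ℝ) (C : ℝ) : Prop :=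
  ∀ t, ∀ᵐ ω ∂μ,
    (μ[fun ω' => ∑ i, (par.rth ^ 2 + π.rate par t i ω' ^ 2) / 2 |
      MeasurableSpace.comap (π.queue par Q₀ t) inferInstance]) ω ≤ C

end Performance

/-- The optimal value of the scheduling problem over all centralized limited-feedback policies. -/
def optimalPower {N M : ℕ} {Ω : Type*} (𝓐 : MeasurableSpace Ω) [MeasurableSpace Ω]
    (par : Params N M) (K : ℕ) (μ : Measure Ω) (H : ℕ → Ω → Fin N → ℂ) : ℝ :=
  sInf {x | ∃ π : Policy M K H 𝓐, π.Feasible par μ ∧ π.limsupPower par μ = x}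

/-- The expected best metric of the subset `Λ` when the queues are `Q`: the expectation, under the
channel statistics, of the minimum over `n ∈ Λ` of `V P_n - Q_n R_n`, where each user uses the
bit-rate level that minimizes its own metric. -/
def subsetValue {N M : ℕ} (par : Params N M) (ν : Measure (Fin N → ℂ)) (V : ℝ) (Q : Fin N → ℝ)
    (Λ : Finset (Fin N)) : ℝ :=
  ∫ h, ⨅ n : Λ, ⨅ m : Fin M, (V * par.power n m (h n) - Q n * par.bitRate m) ∂ν

/-- `π` is a run of the proposed centralized algorithm with weight `V`, initial queues `Q₀` and
power quantizer `q`, ties being broken in any way: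
* phase 1: the feedback subset is optimal for `subsetValue` among all subsets of `K` users;
* phase 2: every reporting user `n` picks a level `ms n` that minimizes its metric (and reports
  the rate and the quantized power);
* phase 3: the user with the smallest reported metric is scheduled, at the level it picked. -/
def Policy.IsProposed {N M K : ℕ} {Ω : Type*} {H : ℕ → Ω → Fin N → ℂ} {𝓐 : MeasurableSpace Ω}
    (π : Policy M K H 𝓐) (par : Params N M) (ν : Measure (Fin N → ℂ)) (V : ℝ)
    (Q₀ : Ω → Fin N → ℝ) (q : ℝ → ℝ) : Prop :=
  ∀ t ω,
    ((π.feedback t ω).card = K ∧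
      ∀ Λ : Finset (Fin N), Λ.card = K →
        subsetValue par ν V (π.queue par Q₀ t ω) (π.feedback t ω) ≤
          subsetValue par ν V (π.queue par Q₀ t ω) Λ) ∧
    ∃ ms : Fin N → Fin M,
      (∀ n ∈ π.feedback t ω, ∀ m,
        V * par.power n (ms n) (H t ω n) - π.queue par Q₀ t ω n * par.bitRate (ms n) ≤
          V * par.power n m (H t ω n) - π.queue par Q₀ t ω n * par.bitRate m) ∧
      π.level t ω = ms (π.user t ω) ∧
      ∀ n ∈ π.feedback t ω,
        V * q (par.power (π.user t ω) (ms (π.user t ω)) (H t ω (π.user t ω)))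
            - π.queue par Q₀ t ω (π.user t ω) * par.bitRate (ms (π.user t ω)) ≤
          V * q (par.power n (ms n) (H t ω n)) - π.queue par Q₀ t ω n * par.bitRate (ms n)

end D2D

end

/-! The queues serve as Lagrange multipliers. Fix weights Q ≥ 0. Whatever a policy knows when it
requests reports is independent of the current channels, so these can be integrated out with the
feedback set frozen; the scheduled user cannot beat the best metric in that set. Hence the minimum
of `subsetValue` over K-sets bounds from below the expected metric V·power − Σ Q_n R_n of every
policy in every slot (`Policy.le_mean_metric`). Averaging over time along feasible policies turns
this into weak duality (`le_optimalPower`): the minimum is at most V P* − rth Σ Q_n. Neither strong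
duality nor an optimal stationary policy is needed.

The algorithm attains this minimum at Q = Q(t), up to 2δV. In the drift of L = Σ Q_n²/2 the terms
rth Σ Q_n then cancel, leaving E L(t+1) + V E P(t) ≤ E L(t) + C + V P* + 2δV
(`Policy.IsProposed.drift`). Telescoping gives the upper bound. Dropping the power instead shows
that E L grows at most linearly, so E Q_n(t) = O(√t) and the throughput constraint holds: the
algorithm is itself feasible, which is the lower bound. -/

noncomputable section

namespace D2D

/-! ### Independence of σ-algebras and freezing -/

section Independence

variable {Ω : Type*} {m₀ : MeasurableSpace Ω} {μ : Measure Ω}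

/-- The sets A ∩ B form a π-system generating the join. On it, split off A from B ∩ D by the first
independence, then B from D by the second. -/
theorem indep_sup_left [IsProbabilityMeasure μ] {m m₁ m₂ : MeasurableSpace Ω} (hm : m ≤ m₀)
    (h₁ : m₁ ≤ m₀) (h₂ : m₂ ≤ m₀) (h : Indep m (m₁ ⊔ m₂) μ) (h₁₂ : Indep m₁ m₂ μ) :
    Indep (m ⊔ m₁) m₂ μ := by
  have hgen : m ⊔ m₁ = MeasurableSpace.generateFrom
      {s | ∃ A B, MeasurableSet[m] A ∧ MeasurableSet[m₁] B ∧ s = A ∩ B} := by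
    apply le_antisymm
    · refine sup_le (fun A hA => ?_) (fun B hB => ?_)
      · exact MeasurableSpace.measurableSet_generateFrom
          ⟨A, Set.univ, hA, @MeasurableSet.univ _ m₁, by simp⟩
      · exact MeasurableSpace.measurableSet_generateFrom
          ⟨Set.univ, B, @MeasurableSet.univ _ m, hB, by simp⟩
    · refine MeasurableSpace.generateFrom_le ?_
      rintro _ ⟨A, B, hA, hB, rfl⟩
      exact @MeasurableSet.inter _ (m ⊔ m₁) _ _ ((le_sup_left : m ≤ m ⊔ m₁) _ hA)
        ((le_sup_right : m₁ ≤ m ⊔ m₁) _ hB)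
  refine IndepSets.indep (sup_le hm h₁) h₂ ?_ (@MeasurableSpace.isPiSystem_measurableSet _ m₂)
    hgen (@MeasurableSpace.generateFrom_measurableSet _ m₂).symm ?_
  · rintro _ ⟨A, B, hA, hB, rfl⟩ _ ⟨A', B', hA', hB', rfl⟩ -
    exact ⟨A ∩ A', B ∩ B', @MeasurableSet.inter _ m _ _ hA hA',
      @MeasurableSet.inter _ m₁ _ _ hB hB', Set.inter_inter_inter_comm A B A' B'⟩
  · rw [IndepSets_iff]
    rintro _ D ⟨A, B, hA, hB, rfl⟩ hD
    rw [Indep_iff] at h h₁₂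
    have hB' := (le_sup_left : m₁ ≤ m₁ ⊔ m₂) _ hB
    have hD' := (le_sup_right : m₂ ≤ m₁ ⊔ m₂) _ hD
    rw [Set.inter_assoc, h A (B ∩ D) hA (@MeasurableSet.inter _ (m₁ ⊔ m₂) _ _ hB' hD'),
      h₁₂ B D hB hD, h A B hA hB', mul_assoc]

/-- Freezing: a function of two independent variables may be integrated over one of them first. -/
theorem integral_comp_of_indepFun [IsProbabilityMeasure μ] {E F : Type*} [MeasurableSpace E]
    [MeasurableSpace F] {Y : Ω → F} {X : Ω → E} (hY : Measurable Y) (hX : Measurable X)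
    (hind : IndepFun Y X μ) {f : F × E → ℝ}
    (hf : Measurable f) (hint : Integrable (fun ω => f (Y ω, X ω)) μ) :
    Integrable (fun ω => ∫ x, f (Y ω, x) ∂(μ.map X)) μ ∧
      ∫ ω, f (Y ω, X ω) ∂μ = ∫ ω, ∫ x, f (Y ω, x) ∂(μ.map X) ∂μ := by
  have hmap := (indepFun_iff_map_prod_eq_prod_map_map hY.aemeasurable hX.aemeasurable).1 hind
  have hYX : Measurable (fun ω => (Y ω, X ω)) := hY.prodMk hX
  have : IsProbabilityMeasure (μ.map X) := Measure.isProbabilityMeasure_map hX.aemeasurable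
  have : IsProbabilityMeasure (μ.map Y) := Measure.isProbabilityMeasure_map hY.aemeasurable
  have hint' : Integrable f (μ.map (fun ω => (Y ω, X ω))) :=
    (integrable_map_measure hf.aestronglyMeasurable hYX.aemeasurable).2 hint
  have h₁ : ∫ ω, f (Y ω, X ω) ∂μ = ∫ z, f z ∂(μ.map (fun ω => (Y ω, X ω))) :=
    (integral_map hYX.aemeasurable hf.aestronglyMeasurable).symm
  rw [hmap] at hint' h₁
  have hleft : Integrable (fun y => ∫ x, f (y, x) ∂(μ.map X)) (μ.map Y) := hint'.integral_prod_left
  rw [integral_prod _ hint', integral_map hY.aemeasurable hleft.aestronglyMeasurable] at h₁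
  exact ⟨(integrable_map_measure hleft.aestronglyMeasurable hY.aemeasurable).1 hleft, h₁⟩

end Independence

/-! ### The metric V P_n − Q_n R_n and its minimum -/

section Metric

variable {N M : ℕ} (par : Params N M)

theorem Params.power_nonneg (n : Fin N) (m : Fin M) (z : ℂ) : 0 ≤ par.power n m z := by
  have h₁ := par.snr_nonneg m
  have h₂ := par.noise_pos.le
  have h₃ := (par.pathLoss_pos n).le
  exact le_min (by positivity) par.pmax_pos.le

theorem Params.power_le (n : Fin N) (m : Fin M) (z : ℂ) : par.power n m z ≤ par.pmax :=
  min_le_right _ _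

theorem Params.measurable_power (n : Fin N) (m : Fin M) : Measurable (par.power n m) := by
  unfold Params.power
  fun_prop

/-- A bound on all the bit rates. -/
def Params.rateBound : ℝ := ∑ m, par.bitRate m

theorem Params.bitRate_le (m : Fin M) : par.bitRate m ≤ par.rateBound :=
  Finset.single_le_sum (fun i _ => par.bitRate_nonneg i) (Finset.mem_univ m)

theorem Params.rateBound_nonneg : 0 ≤ par.rateBound :=
  Finset.sum_nonneg fun i _ => par.bitRate_nonneg i

/-- The smallest metric `V P_n - Q_n R_n` over the users in `Λ` and all levels. -/
def bestMetric (V : ℝ) (Q : Fin N → ℝ) (Λ : Finset (Fin N)) (h : Fin N → ℂ) : ℝ :=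
  ⨅ n : Λ, ⨅ m : Fin M, (V * par.power n m (h n) - Q n * par.bitRate m)

theorem bestMetric_le (V : ℝ) (Q : Fin N → ℝ) {Λ : Finset (Fin N)} (h : Fin N → ℂ) {n : Fin N}
    (hn : n ∈ Λ) (m : Fin M) :
    bestMetric par V Q Λ h ≤ V * par.power n m (h n) - Q n * par.bitRate m :=
  (ciInf_le (Set.finite_range _).bddBelow (⟨n, hn⟩ : Λ)).trans
    (ciInf_le (Set.finite_range _).bddBelow m)

theorem le_bestMetric [Nonempty (Fin M)] {V : ℝ} {Q : Fin N → ℝ} {Λ : Finset (Fin N)}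
    (hΛ : Λ.Nonempty) {h : Fin N → ℂ} {c : ℝ}
    (hc : ∀ n ∈ Λ, ∀ m, c ≤ V * par.power n m (h n) - Q n * par.bitRate m) :
    c ≤ bestMetric par V Q Λ h := by
  have := hΛ.to_subtype
  exact le_ciInf fun n => le_ciInf fun m => hc n n.2 m

/-- The bound is linear in Q, so that integrability of the queues will suffice for integrability of
the metric at random weights. -/
theorem abs_metric_le {V : ℝ} (hV : 0 ≤ V) (Q : Fin N → ℝ) (n : Fin N) (m : Fin M) (z : ℂ) :
    |V * par.power n m z - Q n * par.bitRate m| ≤ V * par.pmax + (∑ i, |Q i|) * par.rateBound := by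
  have h₁ : |V * par.power n m z| ≤ V * par.pmax := by
    rw [abs_of_nonneg (mul_nonneg hV (par.power_nonneg n m z))]
    exact mul_le_mul_of_nonneg_left (par.power_le n m z) hV
  have h₂ : |Q n * par.bitRate m| ≤ (∑ i, |Q i|) * par.rateBound := by
    rw [abs_mul, abs_of_nonneg (par.bitRate_nonneg m)]
    exact mul_le_mul (Finset.single_le_sum (f := fun i => |Q i|) (fun i _ => abs_nonneg _)
      (Finset.mem_univ n)) (par.bitRate_le m) (par.bitRate_nonneg m)
      (Finset.sum_nonneg fun i _ => abs_nonneg _)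
  exact (abs_sub _ _).trans (add_le_add h₁ h₂)

theorem abs_bestMetric_le [Nonempty (Fin M)] {V : ℝ} (hV : 0 ≤ V) (Q : Fin N → ℝ)
    (Λ : Finset (Fin N)) (h : Fin N → ℂ) :
    |bestMetric par V Q Λ h| ≤ V * par.pmax + (∑ i, |Q i|) * par.rateBound := by
  rcases Λ.eq_empty_or_nonempty with rfl | hΛ
  · rw [bestMetric, Real.iInf_of_isEmpty, abs_zero]
    exact add_nonneg (mul_nonneg hV par.pmax_pos.le)
      (mul_nonneg (Finset.sum_nonneg fun i _ => abs_nonneg _) par.rateBound_nonneg)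
  · obtain ⟨n, hn⟩ := hΛ
    rw [abs_le]
    refine ⟨le_bestMetric par ⟨n, hn⟩ fun n _ m =>
      (abs_le.1 (abs_metric_le par hV Q n m _)).1, ?_⟩
    let m : Fin M := Classical.arbitrary _
    exact (bestMetric_le par V Q h hn m).trans (abs_le.1 (abs_metric_le par hV Q n m _)).2

/-- Nonemptiness matters: a real infimum over the empty family is 0, which may lie below the value
of a larger set. -/
theorem bestMetric_anti [Nonempty (Fin M)] (V : ℝ) (Q : Fin N → ℝ) {Λ Λ' : Finset (Fin N)}
    (hΛ : Λ.Nonempty) (hsub : Λ ⊆ Λ') (h : Fin N → ℂ) :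
    bestMetric par V Q Λ' h ≤ bestMetric par V Q Λ h :=
  le_bestMetric par hΛ fun _ hn m => bestMetric_le par V Q h (hsub hn) m

theorem measurable_bestMetric (V : ℝ) (Λ : Finset (Fin N)) :
    Measurable (fun z : (Fin N → ℝ) × (Fin N → ℂ) => bestMetric par V z.1 Λ z.2) := by
  refine Measurable.iInf fun n => Measurable.iInf fun m => ?_
  have := par.measurable_power n m
  fun_prop

theorem integrable_bestMetric [Nonempty (Fin M)] (ν : Measure (Fin N → ℂ)) [IsFiniteMeasure ν]
    {V : ℝ} (hV : 0 ≤ V) (Q : Fin N → ℝ) (Λ : Finset (Fin N)) :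
    Integrable (bestMetric par V Q Λ) ν :=
  Integrable.of_bound
    ((measurable_bestMetric par V Λ).comp measurable_prodMk_left).aestronglyMeasurable _
    (Eventually.of_forall fun h => abs_bestMetric_le par hV Q Λ h)

theorem subsetValue_anti [Nonempty (Fin M)] (ν : Measure (Fin N → ℂ)) [IsFiniteMeasure ν]
    {V : ℝ} (hV : 0 ≤ V) (Q : Fin N → ℝ) {Λ Λ' : Finset (Fin N)} (hΛ : Λ.Nonempty)
    (hsub : Λ ⊆ Λ') : subsetValue par ν V Q Λ' ≤ subsetValue par ν V Q Λ :=
  integral_mono (integrable_bestMetric par ν hV Q Λ') (integrable_bestMetric par ν hV Q Λ)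
    fun h => bestMetric_anti par V Q hΛ hsub h

end Metric

/-! ### Information of the base station versus the full channel history -/

section Information

variable {N M K : ℕ} {Ω : Type*} {H : ℕ → Ω → Fin N → ℂ} {𝓐 : MeasurableSpace Ω}
  {Λ : ℕ → Ω → Finset (Fin N)}

/-- The prior information and all the channels of the earlier slots. -/
abbrev history (H : ℕ → Ω → Fin N → ℂ) (𝓐 : MeasurableSpace Ω) (t : ℕ) : MeasurableSpace Ω :=
  𝓐 ⊔ ⨆ s ∈ Set.Iio t, MeasurableSpace.comap (H s) inferInstance

theorem history_mono : Monotone (history H 𝓐) := fun _ _ hst =>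
  sup_le_sup_left (biSup_mono fun _ hr => lt_of_lt_of_le hr hst) _

theorem measurable_history {s t : ℕ} (hst : s < t) : Measurable[history H 𝓐 t] (H s) := by
  rw [measurable_iff_comap_le]
  exact le_sup_of_le_right (le_biSup (fun s => MeasurableSpace.comap (H s) inferInstance) hst)

/-- A report is the channel vector blanked outside a set which, by strong induction, is itself
determined by the earlier history. This replaces the policy-dependent information by a σ-algebra
common to all policies and independent of the current channels. -/
theorem known_le_history
    (hΛ : ∀ t (A : Finset (Fin N)), MeasurableSet[known H 𝓐 Λ t] {ω | Λ t ω = A}) (t : ℕ) :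
    known H 𝓐 Λ t ≤ history H 𝓐 t := by
  induction t using Nat.strong_induction_on with
  | _ t ih =>
    refine sup_le le_sup_left (iSup_le fun s => ?_)
    rw [← measurable_iff_comap_le]
    refine (@measurable_pi_iff _ _ _ (history H 𝓐 t) _ _).2 fun n => ?_
    refine Measurable.ite ?_ ((measurable_pi_apply n).comp (measurable_history s.2))
      measurable_const
    have hset : {ω | n ∈ Λ s ω} = ⋃ A ∈ {A : Finset (Fin N) | n ∈ A}, {ω | Λ s ω = A} := by
      ext ω; simp
    rw [hset]
    exact MeasurableSet.biUnion (Set.to_countable _) fun A _ =>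
      history_mono s.2.le _ (ih s s.2 _ (hΛ s A))

variable [mΩ : MeasurableSpace Ω] {μ : Measure Ω} {ν : Measure (Fin N → ℂ)}

theorem IsFadingModel.history_le (hH : IsFadingModel 𝓐 μ ν H) (t : ℕ) : history H 𝓐 t ≤ mΩ :=
  sup_le hH.prior_le (iSup₂_le fun s _ => (hH.measurable s).comap_le)

variable [IsProbabilityMeasure μ]

/-- The prior is independent of all channels jointly, and the past channels are independent of the
present ones; `indep_sup_left` combines the two. -/
theorem IsFadingModel.indep_history (hH : IsFadingModel 𝓐 μ ν H) (t : ℕ) :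
    Indep (history H 𝓐 t) (MeasurableSpace.comap (H t) inferInstance) μ := by
  refine indep_sup_left hH.prior_le (iSup₂_le fun s _ => (hH.measurable s).comap_le)
    (hH.measurable t).comap_le (indep_of_indep_of_le_right hH.prior_indep ?_) ?_
  · exact sup_le (iSup₂_le fun s _ => le_iSup (fun t => MeasurableSpace.comap (H t) inferInstance) s)
      (le_iSup (fun t => MeasurableSpace.comap (H t) inferInstance) t)
  · have hdisj : Disjoint (Set.Iio t) {t} := by simp
    have := indep_iSup_of_disjoint (fun s => (hH.measurable s).comap_le)
      ((iIndepFun_iff_iIndep ..).1 hH.iIndep) hdisj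
    simpa using this

theorem IsFadingModel.isProbabilityMeasure (hH : IsFadingModel 𝓐 μ ν H) :
    IsProbabilityMeasure ν :=
  hH.law 0 ▸ Measure.isProbabilityMeasure_map (hH.measurable 0).aemeasurable

end Information

/-! ### Measurability, moments and queue recursion of a policy -/

section Policies

variable {N M K : ℕ} {Ω : Type*} {H : ℕ → Ω → Fin N → ℂ} {𝓐 : MeasurableSpace Ω}
  (par : Params N M) (π : Policy M K H 𝓐)

theorem Policy.nonempty_feedback (t : ℕ) (ω : Ω) : (π.feedback t ω).Nonempty :=
  ⟨_, π.user_mem t ω⟩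

theorem Policy.sum_txPower (t : ℕ) (ω : Ω) :
    ∑ n, π.txPower par t n ω = par.power (π.user t ω) (π.level t ω) (H t ω (π.user t ω)) := by
  simp [Policy.txPower]

theorem Policy.sum_mul_rate (Q : Fin N → ℝ) (t : ℕ) (ω : Ω) :
    ∑ n, Q n * π.rate par t n ω = Q (π.user t ω) * par.bitRate (π.level t ω) := by
  simp [Policy.rate]

theorem Policy.txPower_nonneg (t : ℕ) (n : Fin N) (ω : Ω) : 0 ≤ π.txPower par t n ω := by
  unfold Policy.txPower
  split_ifs
  exacts [par.power_nonneg _ _ _, le_rfl]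

theorem Policy.txPower_le (t : ℕ) (n : Fin N) (ω : Ω) : π.txPower par t n ω ≤ par.pmax := by
  unfold Policy.txPower
  split_ifs
  exacts [par.power_le _ _ _, par.pmax_pos.le]

theorem Policy.rate_nonneg (t : ℕ) (n : Fin N) (ω : Ω) : 0 ≤ π.rate par t n ω := by
  unfold Policy.rate
  split_ifs
  exacts [par.bitRate_nonneg _, le_rfl]

theorem Policy.rate_le (t : ℕ) (n : Fin N) (ω : Ω) : π.rate par t n ω ≤ par.rateBound := by
  unfold Policy.rate
  split_ifs
  exacts [par.bitRate_le _, par.rateBound_nonneg]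

theorem Policy.measurableSet_feedback (t : ℕ) (A : Finset (Fin N)) :
    MeasurableSet[history H 𝓐 t] {ω | π.feedback t ω = A} :=
  known_le_history π.feedback_measurable t _ (π.feedback_measurable t A)

theorem Policy.measurableSet_decision (t : ℕ) (n : Fin N) (m : Fin M) :
    MeasurableSet[history H 𝓐 (t + 1)] {ω | π.user t ω = n ∧ π.level t ω = m} :=
  known_le_history π.feedback_measurable _ _ (π.decision_measurable t n m)

theorem Policy.measurable_rate (t : ℕ) (n : Fin N) :
    Measurable[history H 𝓐 (t + 1)] (π.rate par t n) := by
  have h : π.rate par t n = fun ω => ∑ m, if π.user t ω = n ∧ π.level t ω = m then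
      par.bitRate m else 0 := by
    funext ω
    by_cases hu : π.user t ω = n <;> simp [Policy.rate, hu]
  rw [h]
  exact Finset.measurable_fun_sum _ fun m _ =>
    Measurable.ite (π.measurableSet_decision t n m) measurable_const measurable_const

theorem Policy.measurable_txPower (t : ℕ) (n : Fin N) :
    Measurable[history H 𝓐 (t + 1)] (π.txPower par t n) := by
  have h : π.txPower par t n = fun ω => ∑ m, if π.user t ω = n ∧ π.level t ω = m then
      par.power n m (H t ω n) else 0 := by
    funext ω
    by_cases hu : π.user t ω = n <;> simp [Policy.txPower, hu]
  rw [h]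
  exact Finset.measurable_fun_sum _ fun m _ => Measurable.ite (π.measurableSet_decision t n m)
    ((par.measurable_power n m).comp ((measurable_pi_apply n).comp
      (measurable_history t.lt_succ_self))) measurable_const

variable {Q₀ : Ω → Fin N → ℝ}

theorem Policy.measurable_queue (hQ₀ : Measurable[𝓐] Q₀) (t : ℕ) :
    Measurable[history H 𝓐 t] (π.queue par Q₀ t) := by
  induction t with
  | zero => exact hQ₀.mono le_sup_left le_rfl
  | succ t ih =>
    refine (@measurable_pi_iff _ _ _ (history H 𝓐 (t + 1)) _ _).2 fun n => ?_
    have h₁ : Measurable[history H 𝓐 (t + 1)] (fun ω => π.queue par Q₀ t ω n) :=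
      (measurable_pi_apply n).comp (ih.mono (history_mono t.le_succ) le_rfl)
    exact ((h₁.sub (π.measurable_rate par t n)).max measurable_const).add measurable_const

theorem Policy.queue_nonneg (hQ₀ : ∀ ω n, 0 ≤ Q₀ ω n) (t : ℕ) (ω : Ω) (n : Fin N) :
    0 ≤ π.queue par Q₀ t ω n := by
  cases t with
  | zero => exact hQ₀ ω n
  | succ t => exact add_nonneg (le_max_right _ _) par.rth_nonneg

theorem Policy.queue_sub_rate_le (t : ℕ) (ω : Ω) (n : Fin N) :
    π.queue par Q₀ t ω n - π.rate par t n ω + par.rth ≤ π.queue par Q₀ (t + 1) ω n :=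
  add_le_add_left (le_max_left _ _) _

theorem Policy.queue_succ_le (hQ₀ : ∀ ω n, 0 ≤ Q₀ ω n) (t : ℕ) (ω : Ω) (n : Fin N) :
    π.queue par Q₀ (t + 1) ω n ≤ π.queue par Q₀ t ω n + par.rth :=
  add_le_add_left (max_le (sub_le_self _ (π.rate_nonneg par t n ω))
    (π.queue_nonneg par hQ₀ t ω n)) _

/-- Expand the square of [Q − R]⁺ + rth, using ([Q − R]⁺)² ≤ (Q − R)² for the square and [Q − R]⁺ ≤
Q for the cross term. -/
theorem Policy.queue_succ_sq_le (hQ₀ : ∀ ω n, 0 ≤ Q₀ ω n) (t : ℕ) (ω : Ω) (n : Fin N) :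
    π.queue par Q₀ (t + 1) ω n ^ 2 / 2 ≤ π.queue par Q₀ t ω n ^ 2 / 2 +
      (par.rth ^ 2 + π.rate par t n ω ^ 2) / 2 + par.rth * π.queue par Q₀ t ω n -
      π.queue par Q₀ t ω n * π.rate par t n ω := by
  have hQ := π.queue_nonneg par hQ₀ t ω n
  have hR := π.rate_nonneg par t n ω
  have hr := par.rth_nonneg
  change (max (π.queue par Q₀ t ω n - π.rate par t n ω) 0 + par.rth) ^ 2 / 2 ≤ _
  generalize π.queue par Q₀ t ω n = Q at *
  generalize π.rate par t n ω = R at *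
  have h₁ : max (Q - R) 0 ≤ Q := max_le (sub_le_self _ hR) hQ
  have h₂ : max (Q - R) 0 ^ 2 ≤ (Q - R) ^ 2 := by
    rcases max_choice (Q - R) 0 with h | h <;> rw [h]
    rw [zero_pow two_ne_zero]
    exact sq_nonneg _
  have h₃ := mul_le_mul_of_nonneg_left h₁ hr
  nlinarith

variable [mΩ : MeasurableSpace Ω] {μ : Measure Ω} [IsProbabilityMeasure μ]
  {ν : Measure (Fin N → ℂ)}

theorem Policy.integrable_rate (hH : IsFadingModel 𝓐 μ ν H) (t : ℕ) (n : Fin N) :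
    Integrable (π.rate par t n) μ :=
  Integrable.of_bound
    ((π.measurable_rate par t n).mono (hH.history_le _) le_rfl).aestronglyMeasurable par.rateBound
    (Eventually.of_forall fun ω => by
      rw [Real.norm_of_nonneg (π.rate_nonneg par t n ω)]; exact π.rate_le par t n ω)

theorem Policy.integrable_txPower (hH : IsFadingModel 𝓐 μ ν H) (t : ℕ) (n : Fin N) :
    Integrable (π.txPower par t n) μ :=
  Integrable.of_bound
    ((π.measurable_txPower par t n).mono (hH.history_le _) le_rfl).aestronglyMeasurable par.pmax
    (Eventually.of_forall fun ω => by
      rw [Real.norm_of_nonneg (π.txPower_nonneg par t n ω)]; exact π.txPower_le par t n ω)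

theorem Policy.integral_rate_mem (hH : IsFadingModel 𝓐 μ ν H) (t : ℕ) (n : Fin N) :
    ∫ ω, π.rate par t n ω ∂μ ∈ Set.Icc 0 par.rateBound := by
  refine ⟨integral_nonneg fun ω => π.rate_nonneg par t n ω, ?_⟩
  simpa using integral_mono (π.integrable_rate par hH t n) (integrable_const par.rateBound)
    fun ω => π.rate_le par t n ω

theorem Policy.integral_txPower_mem (hH : IsFadingModel 𝓐 μ ν H) (t : ℕ) (n : Fin N) :
    ∫ ω, π.txPower par t n ω ∂μ ∈ Set.Icc 0 par.pmax := by
  refine ⟨integral_nonneg fun ω => π.txPower_nonneg par t n ω, ?_⟩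
  simpa using integral_mono (π.integrable_txPower par hH t n) (integrable_const par.pmax)
    fun ω => π.txPower_le par t n ω

theorem Policy.integrable_queue_sq (hH : IsFadingModel 𝓐 μ ν H) (hQm : Measurable[𝓐] Q₀)
    (hQ₀ : ∀ ω n, 0 ≤ Q₀ ω n) (hQi : ∀ n, Integrable (fun ω => Q₀ ω n ^ 2) μ) (t : ℕ) (n : Fin N) :
    Integrable (fun ω => π.queue par Q₀ t ω n ^ 2) μ := by
  induction t with
  | zero => exact hQi n
  | succ t ih =>
    have hm : Measurable (π.queue par Q₀ (t + 1)) :=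
      (π.measurable_queue par hQm _).mono (hH.history_le _) le_rfl
    refine ((ih.const_mul 2).add (integrable_const (2 * par.rth ^ 2))).mono'
      (((measurable_pi_apply n).comp hm).pow_const 2).aestronglyMeasurable
      (Eventually.of_forall fun ω => ?_)
    have h₁ := π.queue_succ_le par hQ₀ t ω n
    have h₂ := π.queue_nonneg par hQ₀ (t + 1) ω n
    have h₃ := pow_le_pow_left₀ h₂ h₁ 2
    rw [Real.norm_of_nonneg (sq_nonneg _)]
    simp only [Pi.add_apply]
    nlinarith [sq_nonneg (π.queue par Q₀ t ω n - par.rth)]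

theorem Policy.integrable_queue (hH : IsFadingModel 𝓐 μ ν H) (hQm : Measurable[𝓐] Q₀)
    (hQ₀ : ∀ ω n, 0 ≤ Q₀ ω n) (hQi : ∀ n, Integrable (fun ω => Q₀ ω n ^ 2) μ) (t : ℕ) (n : Fin N) :
    Integrable (fun ω => π.queue par Q₀ t ω n) μ := by
  have hm : Measurable (π.queue par Q₀ t) :=
    (π.measurable_queue par hQm _).mono (hH.history_le _) le_rfl
  refine ((π.integrable_queue_sq par hH hQm hQ₀ hQi t n).add (integrable_const 1)).mono'
    ((measurable_pi_apply n).comp hm).aestronglyMeasurable (Eventually.of_forall fun ω => ?_)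
  rw [Real.norm_of_nonneg (π.queue_nonneg par hQ₀ t ω n)]
  simp only [Pi.add_apply]
  nlinarith [sq_nonneg (π.queue par Q₀ t ω n - 1)]

/-- Joint measurability in the feedback set as well, by splitting over its finitely many values;
freezing at a random set requires it. -/
theorem measurable_bestMetric_finset [MeasurableSpace (Finset (Fin N))]
    [MeasurableSingletonClass (Finset (Fin N))] (V : ℝ) :
    Measurable (fun z : ((Fin N → ℝ) × Finset (Fin N)) × (Fin N → ℂ) =>
      bestMetric par V z.1.1 z.1.2 z.2) := by
  have h : (fun z : ((Fin N → ℝ) × Finset (Fin N)) × (Fin N → ℂ) =>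
      bestMetric par V z.1.1 z.1.2 z.2) =
      fun z => ∑ A, Set.indicator {z | z.1.2 = A} (fun z => bestMetric par V z.1.1 A z.2) z := by
    funext z
    simp [Set.indicator_apply]
  rw [h]
  refine Finset.measurable_fun_sum _ fun A _ => Measurable.indicator ?_ ?_
  · have hz : Measurable fun z : ((Fin N → ℝ) × Finset (Fin N)) × (Fin N → ℂ) =>
      (z.1.1, z.2) := by fun_prop
    have hcomp := (measurable_bestMetric par V A).comp hz
    exact hcomp
  · exact measurable_fst (measurable_snd (measurableSet_singleton A))

/-- The feedback set of a slot and any weights known at its start are independent of the channels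
of this slot. -/
theorem Policy.integral_bestMetric [Nonempty (Fin M)] (hH : IsFadingModel 𝓐 μ ν H) {V : ℝ}
    (hV : 0 ≤ V) (t : ℕ) {Q : Ω → Fin N → ℝ} (hQ : Measurable[history H 𝓐 t] Q)
    (hQi : ∀ n, Integrable (fun ω => Q ω n) μ) :
    Integrable (fun ω => bestMetric par V (Q ω) (π.feedback t ω) (H t ω)) μ ∧
    Integrable (fun ω => subsetValue par ν V (Q ω) (π.feedback t ω)) μ ∧
      ∫ ω, bestMetric par V (Q ω) (π.feedback t ω) (H t ω) ∂μ =
        ∫ ω, subsetValue par ν V (Q ω) (π.feedback t ω) ∂μ := by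
  let : MeasurableSpace (Finset (Fin N)) := ⊤
  let Y : Ω → (Fin N → ℝ) × Finset (Fin N) := fun ω => (Q ω, π.feedback t ω)
  let f : ((Fin N → ℝ) × Finset (Fin N)) × (Fin N → ℂ) → ℝ :=
    fun z => bestMetric par V z.1.1 z.1.2 z.2
  have hfb : Measurable[history H 𝓐 t] (π.feedback t) :=
    @measurable_to_countable' _ _ _ _ (history H 𝓐 t) _ fun A => π.measurableSet_feedback t A
  have hY : Measurable[history H 𝓐 t] Y := Measurable.prodMk hQ hfb
  have hYm : Measurable Y := hY.mono (hH.history_le t) le_rfl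
  have : MeasurableSingletonClass (Finset (Fin N)) := ⟨fun _ => trivial⟩
  have hf : Measurable f := measurable_bestMetric_finset par V
  have hind : IndepFun Y (H t) μ := by
    rw [IndepFun_iff_Indep]
    exact indep_of_indep_of_le_left (hH.indep_history t) hY.comap_le
  have hint : Integrable (fun ω => f (Y ω, H t ω)) μ := by
    refine ((integrable_const (V * par.pmax)).add ((integrable_finsetSum Finset.univ
      fun n _ => (hQi n).abs).mul_const par.rateBound)).mono'
      (hf.comp (hYm.prodMk (hH.measurable t))).aestronglyMeasurable
      (Eventually.of_forall fun ω => ?_)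
    exact abs_bestMetric_le par hV (Q ω) (π.feedback t ω) (H t ω)
  have := integral_comp_of_indepFun hYm (hH.measurable t) hind hf hint
  rw [hH.law t] at this
  exact ⟨hint, this⟩

end Policies

/-! ### Time averages, telescoped drift and mean rate stability -/

section Averages

/-- The average of `u` over the slots `1, …, T`. -/
def average (u : ℕ → ℝ) (T : ℕ) : ℝ := (1 / (T : ℝ)) * ∑ t ∈ Finset.Icc 1 T, u t

theorem average_mono {u v : ℕ → ℝ} (h : ∀ t, u t ≤ v t) (T : ℕ) : average u T ≤ average v T :=
  mul_le_mul_of_nonneg_left (Finset.sum_le_sum fun t _ => h t) (by positivity)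

theorem average_const {T : ℕ} (hT : 1 ≤ T) (c : ℝ) : average (fun _ => c) T = c := by
  have : (T : ℝ) ≠ 0 := by positivity
  simp [average]
  field_simp

theorem average_nonneg {u : ℕ → ℝ} (h : ∀ t, 0 ≤ u t) (T : ℕ) : 0 ≤ average u T :=
  mul_nonneg (by positivity) (Finset.sum_nonneg fun t _ => h t)

theorem average_le {u : ℕ → ℝ} {b : ℝ} (hb : 0 ≤ b) (h : ∀ t, u t ≤ b) (T : ℕ) :
    average u T ≤ b := by
  -- The average over zero slots is 0, whence the assumption 0 ≤ b.
  rcases T.eq_zero_or_pos with rfl | hT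
  · simpa [average] using hb
  · exact (average_mono h T).trans (average_const hT b).le

theorem average_mul_sub_sum {ι : Type*} [Fintype ι] (V : ℝ) (Q : ι → ℝ) (p : ℕ → ℝ)
    (r : ι → ℕ → ℝ) (T : ℕ) :
    average (fun t => V * p t - ∑ n, Q n * r n t) T =
      V * average p T - ∑ n, Q n * average (r n) T := by
  simp only [average, Finset.sum_sub_distrib, mul_sub, ← Finset.mul_sum]
  rw [Finset.sum_comm, mul_left_comm]
  simp only [mul_left_comm (Q _) (1 / (T : ℝ)), ← Finset.mul_sum]

theorem isBoundedUnder_le_average {u : ℕ → ℝ} {b : ℝ} (h : ∀ t, u t ∈ Set.Icc 0 b) :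
    IsBoundedUnder (· ≤ ·) atTop (average u) :=
  isBoundedUnder_of ⟨b, average_le ((h 0).1.trans (h 0).2) fun t => (h t).2⟩

theorem isBoundedUnder_ge_average {u : ℕ → ℝ} {b : ℝ} (h : ∀ t, u t ∈ Set.Icc 0 b) :
    IsBoundedUnder (· ≥ ·) atTop (average u) :=
  isBoundedUnder_of ⟨0, average_nonneg fun t => (h t).1⟩

/-- Summing a drift inequality over the slots `1, …, T`. -/
theorem average_le_of_drift {L u : ℕ → ℝ} {B : ℝ} (hL : ∀ t, 0 ≤ L t)
    (h : ∀ t, L (t + 1) + u t ≤ L t + B) {T : ℕ} (hT : 1 ≤ T) :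
    average u T ≤ B + L 1 / T := by
  have hsum : ∀ T : ℕ, L (T + 1) + ∑ t ∈ Finset.Icc 1 T, u t ≤ L 1 + T * B := by
    intro T
    induction T with
    | zero => simp
    | succ T ih =>
      rw [Finset.sum_Icc_succ_top (by omega)]
      push_cast
      linarith [h (T + 1)]
  have hT' : (0 : ℝ) < T := by positivity
  rw [average, one_div_mul_eq_div, div_le_iff₀ hT', add_mul, div_mul_cancel₀ _ hT'.ne']
  linarith [hsum T, hL (T + 1)]

theorem limsup_average_le_of_drift {L u : ℕ → ℝ} {B b : ℝ} (hL : ∀ t, 0 ≤ L t)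
    (hu : ∀ t, u t ∈ Set.Icc 0 b) (h : ∀ t, L (t + 1) + u t ≤ L t + B) :
    limsup (average u) atTop ≤ B := by
  have hlim : Tendsto (fun T : ℕ => B + L 1 / T) atTop (nhds (B + 0)) :=
    tendsto_const_nhds.add (tendsto_const_div_atTop_nhds_zero_nat _)
  rw [add_zero] at hlim
  rw [← hlim.limsup_eq]
  exact limsup_le_limsup (eventually_atTop.2 ⟨1, fun T hT => average_le_of_drift hL h hT⟩)
    (isBoundedUnder_ge_average hu).isCoboundedUnder_le hlim.isBoundedUnder_le

/-- A virtual queue whose mean square grows at most linearly is mean rate stable, so that its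
service meets its arrivals. -/
theorem le_liminf_average_of_queue {a r S : ℕ → ℝ} {A B b ρ : ℝ} (hr : ∀ t, r t ∈ Set.Icc 0 b)
    (ha : ∀ t, 0 ≤ a t) (haS : ∀ t c, 0 < c → 2 * a t ≤ S t / c + c)
    (hS : ∀ t : ℕ, S t ≤ A + B * t) (h : ∀ t, a t - r t + ρ ≤ a (t + 1)) :
    ρ ≤ liminf (average r) atTop := by
  have hsum : ∀ T : ℕ, T * ρ ≤ a (T + 1) + ∑ t ∈ Finset.Icc 1 T, r t := by
    intro T
    induction T with
    | zero => simpa using ha 1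
    | succ T ih =>
      rw [Finset.sum_Icc_succ_top (by omega)]
      push_cast
      linarith [h (T + 1)]
  -- Since S grows at most linearly, c = √T balances the two terms of `haS` and gives a (T + 1) =
  -- O(√T), negligible after division by T.
  have hlow : ∀ T : ℕ, 1 ≤ T →
      ρ - (((A + B) / T + B) + 1) * (1 / Real.sqrt T) ≤ average r T := by
    intro T hT
    have hT' : (0 : ℝ) < T := by positivity
    have hs : 0 < Real.sqrt T := Real.sqrt_pos.2 hT'
    have hss : Real.sqrt T * Real.sqrt T = T := Real.mul_self_sqrt hT'.le
    have h₁ := haS (T + 1) _ hs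
    have h₂ : S (T + 1) / Real.sqrt T ≤ ((A + B) + B * T) / Real.sqrt T := by
      have := hS (T + 1)
      push_cast at this
      gcongr
      linarith
    have h₃ : a (T + 1) ≤ ((A + B) + B * T) / Real.sqrt T + Real.sqrt T := by
      linarith [ha (T + 1)]
    have h₄ : ((((A + B) / T + B) + 1) * (1 / Real.sqrt T)) * T =
        ((A + B) + B * T) / Real.sqrt T + Real.sqrt T := by
      field_simp
      rw [Real.sq_sqrt hT'.le]
    rw [average, one_div_mul_eq_div, le_div_iff₀ hT', sub_mul, h₄]
    linarith [hsum T]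
  have hlim : Tendsto (fun T : ℕ => ρ - (((A + B) / T + B) + 1) * (1 / Real.sqrt T)) atTop
      (nhds (ρ - ((0 + B) + 1) * 0)) := by
    refine tendsto_const_nhds.sub ((((tendsto_const_div_atTop_nhds_zero_nat _).add
      tendsto_const_nhds).add tendsto_const_nhds).mul ?_)
    simp only [one_div]
    exact tendsto_inv_atTop_zero.comp (Real.tendsto_sqrt_atTop.comp tendsto_natCast_atTop_atTop)
  rw [mul_zero, sub_zero] at hlim
  rw [← hlim.liminf_eq]
  exact liminf_le_liminf (eventually_atTop.2 ⟨1, hlow⟩) hlim.isBoundedUnder_ge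
    (isBoundedUnder_le_average hr).isCoboundedUnder_ge

end Averages

/-! ### Weak duality for time averages -/

section Duality

variable {N M K : ℕ} {Ω : Type*} {H : ℕ → Ω → Fin N → ℂ} {𝓐 : MeasurableSpace Ω}
  (par : Params N M) (π : Policy M K H 𝓐) [mΩ : MeasurableSpace Ω] {μ : Measure Ω}

/-- The expected total power of a slot. -/
def Policy.meanPower (μ : Measure Ω) (t : ℕ) : ℝ := ∑ n, ∫ ω, π.txPower par t n ω ∂μ

variable [IsProbabilityMeasure μ] {ν : Measure (Fin N → ℂ)}

theorem Policy.meanPower_mem (hH : IsFadingModel 𝓐 μ ν H) (t : ℕ) :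
    π.meanPower par μ t ∈ Set.Icc 0 (N * par.pmax) := by
  refine ⟨Finset.sum_nonneg fun n _ => (π.integral_txPower_mem par hH t n).1, ?_⟩
  simpa [Policy.meanPower] using Finset.sum_le_card_nsmul Finset.univ _ _
    fun n _ => (π.integral_txPower_mem par hH t n).2

theorem Policy.nonempty_level (μ : Measure Ω) [IsProbabilityMeasure μ] (π : Policy M K H 𝓐) :
    Nonempty (Fin M) :=
  let ⟨ω⟩ := nonempty_of_isProbabilityMeasure μ
  ⟨π.level 0 ω⟩

/-- With constant weights, no policy beats the best feedback set in any slot. -/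
theorem Policy.le_mean_metric (hH : IsFadingModel 𝓐 μ ν H) (hKN : K ≤ N) {V c : ℝ} (hV : 0 ≤ V)
    {Q : Fin N → ℝ} (hc : ∀ Λ : Finset (Fin N), Λ.card = K → c ≤ subsetValue par ν V Q Λ) (t : ℕ) :
    c ≤ V * π.meanPower par μ t - ∑ n, Q n * ∫ ω, π.rate par t n ω ∂μ := by
  have := π.nonempty_level μ
  have := hH.isProbabilityMeasure
  obtain ⟨h₁, h₂, h₃⟩ := π.integral_bestMetric par hH hV t (Q := fun _ => Q) measurable_const
    fun n => integrable_const _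
  have hP : Integrable (fun ω => V * ∑ n, π.txPower par t n ω) μ :=
    (integrable_finsetSum _ fun n _ => π.integrable_txPower par hH t n).const_mul V
  have hR : Integrable (fun ω => ∑ n, Q n * π.rate par t n ω) μ :=
    integrable_finsetSum _ fun n _ => (π.integrable_rate par hH t n).const_mul _
  calc c = ∫ _, c ∂μ := by simp
    _ ≤ ∫ ω, subsetValue par ν V Q (π.feedback t ω) ∂μ := by
        refine integral_mono (integrable_const c) h₂ fun ω => ?_
        -- A policy may request fewer than K reports; enlarging the set to exactly K users, possible
        -- as K ≤ N, only lowers its value.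
        obtain ⟨Λ, hsub, hcard⟩ := Finset.exists_superset_card_eq (π.card_feedback_le t ω)
          (by simpa using hKN)
        exact (hc Λ hcard).trans
          (subsetValue_anti par ν hV Q (π.nonempty_feedback t ω) hsub)
    _ = ∫ ω, bestMetric par V Q (π.feedback t ω) (H t ω) ∂μ := h₃.symm
    _ ≤ ∫ ω, (V * ∑ n, π.txPower par t n ω - ∑ n, Q n * π.rate par t n ω) ∂μ := by
        refine integral_mono h₁ (hP.sub hR) fun ω => ?_
        simp only [π.sum_txPower, π.sum_mul_rate]
        exact bestMetric_le par V Q (H t ω) (π.user_mem t ω) _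
    _ = _ := by
        rw [integral_sub hP hR, integral_const_mul,
          integral_finsetSum _ fun n _ => π.integrable_txPower par hH t n,
          integral_finsetSum _ fun n _ => (π.integrable_rate par hH t n).const_mul _]
        simp only [integral_const_mul]
        rfl

/-- Average the slotwise bound. An upper bound on the limsup of power and lower bounds on the
liminfs of the rates all hold eventually, up to ε, so one common horizon T serves; Q ≥ 0 lets the
rate bounds be weighted. -/
theorem Policy.Feasible.le_limsupPower {π : Policy M K H 𝓐} (hπ : π.Feasible par μ)
    (hH : IsFadingModel 𝓐 μ ν H) (hKN : K ≤ N) {V c : ℝ} (hV : 0 ≤ V) {Q : Fin N → ℝ}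
    (hQ : ∀ n, 0 ≤ Q n)
    (hc : ∀ Λ : Finset (Fin N), Λ.card = K → c ≤ subsetValue par ν V Q Λ) :
    c ≤ V * π.limsupPower par μ - par.rth * ∑ n, Q n := by
  have hslot := π.le_mean_metric par hH hKN hV hc
  have hkey : ∀ ε > 0, c - V * π.limsupPower par μ + par.rth * ∑ n, Q n ≤
      ε * (V + ∑ n, Q n) := by
    intro ε hε
    have hp : ∀ᶠ T in atTop, average (π.meanPower par μ) T < π.limsupPower par μ + ε :=
      eventually_lt_of_limsup_lt (lt_add_of_pos_right _ hε)
        (isBoundedUnder_le_average (π.meanPower_mem par hH))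
    have hr : ∀ᶠ T in atTop, ∀ n,
        par.rth - ε < average (fun t => ∫ ω, π.rate par t n ω ∂μ) T :=
      eventually_all.2 fun n => eventually_lt_of_lt_liminf
        ((sub_lt_self _ hε).trans_le (hπ n))
        (isBoundedUnder_ge_average fun t => π.integral_rate_mem par hH t n)
    obtain ⟨T, hpT, hrT, hT⟩ := (hp.and (hr.and (eventually_ge_atTop 1))).exists
    have h₁ := average_mono hslot T
    rw [average_const hT, average_mul_sub_sum V Q _ fun n t => ∫ ω, π.rate par t n ω ∂μ] at h₁
    have h₂ : ∑ n, Q n * (par.rth - ε) ≤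
        ∑ n, Q n * average (fun t => ∫ ω, π.rate par t n ω ∂μ) T :=
      Finset.sum_le_sum fun n _ => mul_le_mul_of_nonneg_left (hrT n).le (hQ n)
    rw [← Finset.sum_mul] at h₂
    have h₃ := mul_le_mul_of_nonneg_left hpT.le hV
    linarith
  have hlim : Tendsto (fun ε : ℝ => ε * (V + ∑ n, Q n)) (nhdsWithin 0 (Set.Ioi 0)) (nhds 0) := by
    have : Tendsto (fun ε : ℝ => ε * (V + ∑ n, Q n)) (nhds 0) (nhds (0 * (V + ∑ n, Q n))) :=
      tendsto_id.mul_const _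
    rw [zero_mul] at this
    exact this.mono_left nhdsWithin_le_nhds
  linarith [ge_of_tendsto hlim (eventually_nhdsWithin_of_forall hkey)]

theorem Policy.limsupPower_nonneg (hH : IsFadingModel 𝓐 μ ν H) : 0 ≤ π.limsupPower par μ :=
  le_limsup_of_frequently_le (Frequently.of_forall fun T =>
    average_nonneg (fun t => (π.meanPower_mem par hH t).1) T)
    (isBoundedUnder_le_average (π.meanPower_mem par hH))

theorem Policy.Feasible.optimalPower_le {π : Policy M K H 𝓐} (hπ : π.Feasible par μ)
    (hH : IsFadingModel 𝓐 μ ν H) : optimalPower 𝓐 par K μ H ≤ π.limsupPower par μ :=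
  csInf_le ⟨0, by rintro _ ⟨π', -, rfl⟩; exact π'.limsupPower_nonneg par hH⟩ ⟨π, hπ, rfl⟩

/-- Weak duality. -/
theorem le_optimalPower (hH : IsFadingModel 𝓐 μ ν H) (hKN : K ≤ N)
    (hfeas : ∃ π : Policy M K H 𝓐, π.Feasible par μ) {V c : ℝ} (hV : 0 < V) {Q : Fin N → ℝ}
    (hQ : ∀ n, 0 ≤ Q n)
    (hc : ∀ Λ : Finset (Fin N), Λ.card = K → c ≤ subsetValue par ν V Q Λ) :
    c ≤ V * optimalPower 𝓐 par K μ H - par.rth * ∑ n, Q n := by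
  have h : (c + par.rth * ∑ n, Q n) / V ≤ optimalPower 𝓐 par K μ H := by
    obtain ⟨π, hπ⟩ := hfeas
    -- Feasibility of some policy is essential: the real infimum of the empty set would be 0.
    refine le_csInf ⟨_, π, hπ, rfl⟩ ?_
    rintro _ ⟨π', hπ', rfl⟩
    rw [div_le_iff₀' hV]
    linarith [hπ'.le_limsupPower par hH hKN hV.le hQ hc]
  rw [div_le_iff₀' hV] at h
  linarith

end Duality

/-! ### Drift-plus-penalty analysis of the algorithm -/

section Proposed

variable {N M K : ℕ} {Ω : Type*} {H : ℕ → Ω → Fin N → ℂ} {𝓐 : MeasurableSpace Ω}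
  {par : Params N M} {π : Policy M K H 𝓐} {Q₀ : Ω → Fin N → ℝ} {q : ℝ → ℝ} {V δ : ℝ}
  {ν : Measure (Fin N → ℂ)}

/-- Quantization costs at most `2 δ` per slot. -/
theorem Policy.IsProposed.metric_le (hπ : π.IsProposed par ν V Q₀ q) (hV : 0 ≤ V)
    (hq : ∀ p ∈ Set.Icc 0 par.pmax, |q p - p| ≤ δ) (t : ℕ) (ω : Ω) :
    V * ∑ n, π.txPower par t n ω - ∑ n, π.queue par Q₀ t ω n * π.rate par t n ω ≤
      bestMetric par V (π.queue par Q₀ t ω) (π.feedback t ω) (H t ω) + 2 * δ * V := by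
  obtain ⟨-, ms, hms, hl, hu⟩ := hπ t ω
  have : Nonempty (Fin M) := ⟨π.level t ω⟩
  rw [π.sum_txPower, π.sum_mul_rate, hl, ← sub_le_iff_le_add]
  refine le_bestMetric par (π.nonempty_feedback t ω) fun n hn m => ?_
  have hb : ∀ k, |q (par.power k (ms k) (H t ω k)) - par.power k (ms k) (H t ω k)| ≤ δ :=
    fun k => hq _ ⟨par.power_nonneg _ _ _, par.power_le _ _ _⟩
  -- One δV is lost in passing to the reported metric of the scheduled user, another in returning to
  -- the true metric of its competitor n.
  have h₁ := mul_le_mul_of_nonneg_left (abs_le.1 (hb n)).2 hV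
  have h₂ := mul_le_mul_of_nonneg_left (abs_le.1 (hb (π.user t ω))).1 hV
  linarith [hms n hn m, hu n hn]

variable [mΩ : MeasurableSpace Ω] {μ : Measure Ω}

/-- The expected Lyapunov function. -/
def Policy.lyapunov (par : Params N M) (π : Policy M K H 𝓐) (Q₀ : Ω → Fin N → ℝ)
    (μ : Measure Ω) (t : ℕ) : ℝ :=
  ∫ ω, ∑ n, π.queue par Q₀ t ω n ^ 2 / 2 ∂μ

theorem Policy.lyapunov_nonneg (t : ℕ) : 0 ≤ π.lyapunov par Q₀ μ t :=
  integral_nonneg fun _ => Finset.sum_nonneg fun _ _ => by positivity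

variable [IsProbabilityMeasure μ]

theorem Policy.integrable_secondMoment (hH : IsFadingModel 𝓐 μ ν H) (t : ℕ) :
    Integrable (fun ω => ∑ i, (par.rth ^ 2 + π.rate par t i ω ^ 2) / 2) μ := by
  refine integrable_finsetSum _ fun i _ => ((integrable_const _).add ?_).div_const 2
  refine Integrable.of_bound ((((π.measurable_rate par t i).mono (hH.history_le _)
    le_rfl).pow_const 2).aestronglyMeasurable) (par.rateBound ^ 2) (Eventually.of_forall fun ω => ?_)
  rw [Real.norm_of_nonneg (sq_nonneg _)]
  exact pow_le_pow_left₀ (π.rate_nonneg par t i ω) (π.rate_le par t i ω) 2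

/-- By the tower property. The drift argument uses the conditional bound only through this
expectation. -/
theorem Policy.IsDriftConstant.integral_le {C : ℝ} (hC : π.IsDriftConstant par μ Q₀ C)
    (hH : IsFadingModel 𝓐 μ ν H) (hQm : Measurable[𝓐] Q₀) (t : ℕ) :
    ∫ ω, ∑ i, (par.rth ^ 2 + π.rate par t i ω ^ 2) / 2 ∂μ ≤ C := by
  have hm : Measurable (π.queue par Q₀ t) :=
    (π.measurable_queue par hQm _).mono (hH.history_le _) le_rfl
  rw [← integral_condExp hm.comap_le]
  simpa using integral_mono_ae integrable_condExp (integrable_const C) (hC t)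

/-- Bounding every rate by `par.rateBound` yields a constant that involves only the number of users
and the parameters of the cell. -/
theorem Policy.isDriftConstant (hH : IsFadingModel 𝓐 μ ν H) (hQm : Measurable[𝓐] Q₀) :
    π.IsDriftConstant par μ Q₀ (N * ((par.rth ^ 2 + par.rateBound ^ 2) / 2)) := by
  intro t
  have hm : Measurable (π.queue par Q₀ t) :=
    (π.measurable_queue par hQm _).mono (hH.history_le _) le_rfl
  have h := condExp_mono (m := MeasurableSpace.comap (π.queue par Q₀ t) inferInstance)
    (π.integrable_secondMoment (par := par) hH t)
    (integrable_const (μ := μ) (N * ((par.rth ^ 2 + par.rateBound ^ 2) / 2)))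
    (Eventually.of_forall fun ω => ?_)
  · rwa [condExp_const hm.comap_le] at h
  · have hi : ∀ i ∈ Finset.univ, (par.rth ^ 2 + π.rate par t i ω ^ 2) / 2 ≤
        (par.rth ^ 2 + par.rateBound ^ 2) / 2 := fun i _ => by
      have := pow_le_pow_left₀ (π.rate_nonneg par t i ω) (π.rate_le par t i ω) 2
      linarith
    have hsum := Finset.sum_le_card_nsmul Finset.univ _ _ hi
    rwa [nsmul_eq_mul, Finset.card_univ, Fintype.card_fin] at hsum

/-- The drift-plus-penalty inequality. -/
theorem Policy.IsProposed.drift (hπ : π.IsProposed par ν V Q₀ q) (hV : 0 < V)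
    (hq : ∀ p ∈ Set.Icc 0 par.pmax, |q p - p| ≤ δ) (hH : IsFadingModel 𝓐 μ ν H) (hKN : K ≤ N)
    (hfeas : ∃ π : Policy M K H 𝓐, π.Feasible par μ) (hQm : Measurable[𝓐] Q₀)
    (hQ₀ : ∀ ω n, 0 ≤ Q₀ ω n) (hQi : ∀ n, Integrable (fun ω => Q₀ ω n ^ 2) μ) {C : ℝ}
    (hC : π.IsDriftConstant par μ Q₀ C) (t : ℕ) :
    π.lyapunov par Q₀ μ (t + 1) + V * π.meanPower par μ t ≤
      π.lyapunov par Q₀ μ t + (C + V * optimalPower 𝓐 par K μ H + 2 * δ * V) := by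
  have := π.nonempty_level μ
  set Popt := optimalPower 𝓐 par K μ H
  have hQ1 := π.integrable_queue par hH hQm hQ₀ hQi t
  obtain ⟨h₁, h₂, h₃⟩ := π.integral_bestMetric par hH hV.le t (π.measurable_queue par hQm t) hQ1
  have hL : ∀ t, Integrable (fun ω => ∑ n, π.queue par Q₀ t ω n ^ 2 / 2) μ := fun t =>
    integrable_finsetSum _ fun n _ => (π.integrable_queue_sq par hH hQm hQ₀ hQi t n).div_const 2
  have hP : Integrable (fun ω => V * ∑ n, π.txPower par t n ω) μ :=
    (integrable_finsetSum _ fun n _ => π.integrable_txPower par hH t n).const_mul V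
  have hS := π.integrable_secondMoment (par := par) hH t
  have hsumQ : Integrable (fun ω => par.rth * ∑ n, π.queue par Q₀ t ω n) μ :=
    (integrable_finsetSum _ fun n _ => hQ1 n).const_mul _
  have hpt : ∀ ω, ∑ n, π.queue par Q₀ (t + 1) ω n ^ 2 / 2 + V * ∑ n, π.txPower par t n ω ≤
      ∑ n, π.queue par Q₀ t ω n ^ 2 / 2 + ∑ i, (par.rth ^ 2 + π.rate par t i ω ^ 2) / 2 +
        par.rth * ∑ n, π.queue par Q₀ t ω n +
        (bestMetric par V (π.queue par Q₀ t ω) (π.feedback t ω) (H t ω) + 2 * δ * V) := by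
    intro ω
    have h := Finset.sum_le_sum fun n (_ : n ∈ Finset.univ) => π.queue_succ_sq_le par hQ₀ t ω n
    rw [Finset.sum_sub_distrib, Finset.sum_add_distrib, Finset.sum_add_distrib,
      ← Finset.mul_sum] at h
    linarith [hπ.metric_le hV.le hq t ω]
  have hI := integral_mono ((hL (t + 1)).add hP)
    ((((hL t).add hS).add hsumQ).add (h₁.add (integrable_const (2 * δ * V)))) hpt
  -- Weak duality is applied separately at each ω, with the realized queues as multipliers; the set
  -- chosen in phase 1 attains the minimum over K-sets. The term rth Σ Q_n cancels the one in `hpt`.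
  have hbest : ∫ ω, subsetValue par ν V (π.queue par Q₀ t ω) (π.feedback t ω) ∂μ ≤
      V * Popt - ∫ ω, par.rth * ∑ n, π.queue par Q₀ t ω n ∂μ := by
    have h := integral_mono h₂ ((integrable_const (V * Popt)).sub hsumQ) fun ω =>
      le_optimalPower par hH hKN hfeas hV (π.queue_nonneg par hQ₀ t ω) (hπ t ω).1.2
    rw [integral_sub' (integrable_const _) hsumQ] at h
    simpa using h
  rw [integral_add' (hL (t + 1)) hP, integral_add' (((hL t).add hS).add hsumQ)
    (h₁.add (integrable_const _)), integral_add' ((hL t).add hS) hsumQ, integral_add' (hL t) hS,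
    integral_add' h₁ (integrable_const _), h₃, integral_const_mul,
    integral_finsetSum _ fun n _ => π.integrable_txPower par hH t n] at hI
  simp only [integral_const, probReal_univ, one_smul] at hI
  have hC' := hC.integral_le hH hQm t
  simp only [Policy.lyapunov, Policy.meanPower]
  linarith

theorem Policy.IsProposed.limsupPower_le (hπ : π.IsProposed par ν V Q₀ q) (hV : 0 < V)
    (hq : ∀ p ∈ Set.Icc 0 par.pmax, |q p - p| ≤ δ) (hH : IsFadingModel 𝓐 μ ν H) (hKN : K ≤ N)
    (hfeas : ∃ π : Policy M K H 𝓐, π.Feasible par μ) (hQm : Measurable[𝓐] Q₀)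
    (hQ₀ : ∀ ω n, 0 ≤ Q₀ ω n) (hQi : ∀ n, Integrable (fun ω => Q₀ ω n ^ 2) μ) {C : ℝ}
    (hC : π.IsDriftConstant par μ Q₀ C) :
    π.limsupPower par μ ≤ optimalPower 𝓐 par K μ H + C / V + 2 * δ := by
  refine limsup_average_le_of_drift (L := fun t => π.lyapunov par Q₀ μ t / V)
    (fun t => div_nonneg (π.lyapunov_nonneg t) hV.le) (π.meanPower_mem par hH) fun t => ?_
  have h := div_le_div_of_nonneg_right (hπ.drift hV hq hH hKN hfeas hQm hQ₀ hQi hC t) hV.le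
  have e₁ : (π.lyapunov par Q₀ μ (t + 1) + V * π.meanPower par μ t) / V =
      π.lyapunov par Q₀ μ (t + 1) / V + π.meanPower par μ t := by field_simp
  have e₂ : (π.lyapunov par Q₀ μ t + (C + V * optimalPower 𝓐 par K μ H + 2 * δ * V)) / V =
      π.lyapunov par Q₀ μ t / V + (optimalPower 𝓐 par K μ H + C / V + 2 * δ) := by
    field_simp
    ring
  rwa [e₁, e₂] at h

/-- Discarding the nonnegative power in the drift inequality leaves linear growth of the expected
Lyapunov function, so every queue is mean rate stable. -/
theorem Policy.IsProposed.feasible (hπ : π.IsProposed par ν V Q₀ q) (hV : 0 < V)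
    (hq : ∀ p ∈ Set.Icc 0 par.pmax, |q p - p| ≤ δ) (hH : IsFadingModel 𝓐 μ ν H) (hKN : K ≤ N)
    (hfeas : ∃ π : Policy M K H 𝓐, π.Feasible par μ) (hQm : Measurable[𝓐] Q₀)
    (hQ₀ : ∀ ω n, 0 ≤ Q₀ ω n) (hQi : ∀ n, Integrable (fun ω => Q₀ ω n ^ 2) μ) :
    π.Feasible par μ := by
  intro n
  set D : ℝ := N * ((par.rth ^ 2 + par.rateBound ^ 2) / 2) +
    V * optimalPower 𝓐 par K μ H + 2 * δ * V
  have hQ1 := fun t => π.integrable_queue par hH hQm hQ₀ hQi t n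
  have hQ2 := π.integrable_queue_sq par hH hQm hQ₀ hQi
  have hL : ∀ t : ℕ, π.lyapunov par Q₀ μ t ≤ π.lyapunov par Q₀ μ 0 + D * t := by
    intro t
    induction t with
    | zero => simp
    | succ t ih =>
      have h := hπ.drift hV hq hH hKN hfeas hQm hQ₀ hQi (π.isDriftConstant hH hQm) t
      have hP := mul_nonneg hV.le (π.meanPower_mem par hH t).1
      have hD : π.lyapunov par Q₀ μ (t + 1) + V * π.meanPower par μ t ≤
          π.lyapunov par Q₀ μ t + D := h
      push_cast
      linarith
  -- The factors 2 in A and B come from E Q_n² ≤ 2 E L. The required bound 2 E Q_n ≤ E Q_n² / c + c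
  -- is the expectation of (Q_n − c)² ≥ 0, divided by c.
  refine le_liminf_average_of_queue (a := fun t => ∫ ω, π.queue par Q₀ t ω n ∂μ)
    (S := fun t => ∫ ω, π.queue par Q₀ t ω n ^ 2 ∂μ) (A := 2 * π.lyapunov par Q₀ μ 0)
    (B := 2 * D) (fun t => π.integral_rate_mem par hH t n)
    (fun t => integral_nonneg fun ω => π.queue_nonneg par hQ₀ t ω n) ?_ ?_ ?_
  · intro t c hc
    have h := integral_mono ((hQ1 t).const_mul 2)
      (((hQ2 t n).div_const c).add (integrable_const c)) fun ω => ?_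
    · rw [integral_add' ((hQ2 t n).div_const c) (integrable_const c), integral_const_mul,
        integral_div] at h
      simpa using h
    · simp only [Pi.add_apply]
      rw [div_add' _ _ _ hc.ne', le_div_iff₀ hc]
      linarith [sq_nonneg (π.queue par Q₀ t ω n - c)]
  · intro t
    have h : ∫ ω, π.queue par Q₀ t ω n ^ 2 / 2 ∂μ ≤ π.lyapunov par Q₀ μ t :=
      integral_mono ((hQ2 t n).div_const 2)
        (integrable_finsetSum _ fun n _ => (hQ2 t n).div_const 2) fun ω =>
        Finset.single_le_sum (f := fun n => π.queue par Q₀ t ω n ^ 2 / 2)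
          (fun i _ => by positivity) (Finset.mem_univ n)
    rw [integral_div] at h
    linarith [hL t]
  · intro t
    have h := integral_mono (((hQ1 t).sub (π.integrable_rate par hH t n)).add
      (integrable_const par.rth)) (hQ1 (t + 1)) fun ω => π.queue_sub_rate_le par t ω n
    rw [integral_add' ((hQ1 t).sub (π.integrable_rate par hH t n)) (integrable_const _),
      integral_sub' (hQ1 t) (π.integrable_rate par hH t n)] at h
    simpa using h

end Proposed

end D2D

end

theorem mainTheorem2 {N M K : ℕ} (hK : 1 ≤ K) (hKN : K ≤ N) (par : D2D.Params N M)
    {Ω : Type*} (𝓐 : MeasurableSpace Ω) [MeasurableSpace Ω]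
    (μ : MeasureTheory.Measure Ω)
    [MeasureTheory.IsProbabilityMeasure μ] (ν : MeasureTheory.Measure (Fin N → ℂ))
    (H : ℕ → Ω → Fin N → ℂ) (hH : D2D.IsFadingModel 𝓐 μ ν H)
    (hfeas : ∃ π : D2D.Policy M K H 𝓐, π.Feasible par μ) :
    ∃ C₀ : ℝ, ∀ V : ℝ, 0 < V →
      ∀ Q₀ : Ω → Fin N → ℝ, Measurable[𝓐] Q₀ → (∀ ω n, 0 ≤ Q₀ ω n) →
        (∀ n, MeasureTheory.Integrable (fun ω => Q₀ ω n ^ 2) μ) →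
      ∀ (q : ℝ → ℝ) (δ : ℝ), (∀ p ∈ Set.Icc 0 par.pmax, |q p - p| ≤ δ) →
      ∀ π : D2D.Policy M K H 𝓐, π.IsProposed par ν V Q₀ q →
        π.IsDriftConstant par μ Q₀ C₀ ∧
        ∀ C : ℝ, π.IsDriftConstant par μ Q₀ C →
          D2D.optimalPower 𝓐 par K μ H ≤ π.limsupPower par μ ∧
          π.limsupPower par μ ≤ D2D.optimalPower 𝓐 par K μ H + C / V + 2 * δ :=
  -- The witness C₀ is the explicit constant of `Policy.isDriftConstant`. The lower bound holds
  -- because the algorithm is feasible and so competes in the infimum.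
  ⟨_, fun _ hV _ hQm hQ₀ hQi _ _ hq π hπ => ⟨π.isDriftConstant hH hQm, fun _ hC =>
    ⟨(hπ.feasible hV hq hH hKN hfeas hQm hQ₀ hQi).optimalPower_le par hH,
      hπ.limsupPower_le hV hq hH hKN hfeas hQm hQ₀ hQi hC⟩⟩⟩
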